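/- For a finite group $G$ and an integer $n\ge 1$, let $$cp_n(G)=\frac{\left|\{(g_1,\dots,g_n)\in G^n : g_ig_j=g_jg_i \text{ for all } i\ne j\}\right|}{|G|^n}$$ be the probability that $n$ randomly chosen elements of $G$ commute pairwise. Let $q$ be a prime power, let $\mathbf F_q$ be the field with $q$ elements and $\mathbf F_{q^2}$ its quadratic extension. For a matrix $A=(a_{ij})$ over $\mathbf F_{q^2}$ let $A^*=(a_{ji}^{\,q})$ be its conjugate transpose, and let $$U_2(\mathbf F_q)=\{A\in GL_2(\mathbf F_{q^2}) : A^*A=I\}$$ be the finite unitary group. Then for every integer $n\ge 2$, $$cp_n(GL_2(\mathbf F_q))=cp_n(U_2(\mathbf F_q)).$$ -/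

import Mathlib

open scoped MatrixGroups

/-- The set `G^(n)` of `n`-tuples of elements of `G` that commute pairwise. -/
def commutingTuples (n : ℕ) (G : Type*) [Group G] : Set (Fin n → G) :=
  {g | ∀ i j : Fin n, i ≠ j → g i * g j = g j * g i}

/-- The probability `cp_n(G) = |G^(n)| / |G|^n` that `n` elements of a finite group `G`,
chosen uniformly and independently at random, commute pairwise. -/
noncomputable def commutingProbability (n : ℕ) (G : Type*) [Group G] : ℚ :=
  (Nat.card (commutingTuples n G) : ℚ) / (Nat.card G : ℚ) ^ n

/-- The conjugate transpose `A* = (σ(A))ᵀ` of a square matrix over `K`, where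
`σ : x ↦ x ^ |F|` is the `|F|`-power Frobenius automorphism of `K` over the finite field `F`.
When `[K : F] = 2`, `σ` is the nontrivial automorphism of `K` over `F`. -/
noncomputable def frobeniusConjTranspose (F K : Type*) [Field F] [Fintype F] [Field K]
    [Algebra F K] {d : ℕ} (A : Matrix (Fin d) (Fin d) K) : Matrix (Fin d) (Fin d) K :=
  (A.map (FiniteField.frobeniusAlgHom F K)).transpose

theorem frobeniusConjTranspose_mul (F K : Type*) [Field F] [Fintype F] [Field K]
    [Algebra F K] {d : ℕ} (A B : Matrix (Fin d) (Fin d) K) :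
    frobeniusConjTranspose F K (A * B) =
      frobeniusConjTranspose F K B * frobeniusConjTranspose F K A := by
  simp only [frobeniusConjTranspose]
  rw [Matrix.map_mul, Matrix.transpose_mul]

theorem frobeniusConjTranspose_one (F K : Type*) [Field F] [Fintype F] [Field K]
    [Algebra F K] {d : ℕ} :
    frobeniusConjTranspose F K (1 : Matrix (Fin d) (Fin d) K) = 1 := by
  simp only [frobeniusConjTranspose]
  rw [Matrix.map_one _ (map_zero _) (map_one _), Matrix.transpose_one]

/-- For a finite field `F` with `q` elements and its quadratic extension `K`, the finite unitary
group `U_d(F_q)`: the group of all `A ∈ GL_d(K)` with `A* A = 1`, i.e. the isometry group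
of the standard Hermitian form on `K^d`. -/
noncomputable def finiteUnitaryGroup (d : ℕ) (F K : Type*) [Field F] [Fintype F] [Field K]
    [Algebra F K] : Subgroup (GL (Fin d) K) where
  carrier := {A | frobeniusConjTranspose F K A.val * A.val = 1}
  one_mem' := by
    simp [frobeniusConjTranspose_one]
  mul_mem' := by
    intro A B hA hB
    simp only [Set.mem_setOf_eq, Units.val_mul, frobeniusConjTranspose_mul] at hA hB ⊢
    rw [Matrix.mul_assoc, ← Matrix.mul_assoc _ A.val B.val, hA, Matrix.one_mul, hB]
  inv_mem' := by
    intro A hA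
    simp only [Set.mem_setOf_eq] at hA ⊢
    have h : frobeniusConjTranspose F K A.val = (A⁻¹).val := by
      calc frobeniusConjTranspose F K A.val
          = frobeniusConjTranspose F K A.val * (A.val * (A⁻¹).val) := by
            rw [← Units.val_mul, mul_inv_cancel, Units.val_one, mul_one]
        _ = (A⁻¹).val := by rw [← mul_assoc, hA, one_mul]
    have h2 := frobeniusConjTranspose_mul F K A.val (A⁻¹).val
    rw [← Units.val_mul, mul_inv_cancel, Units.val_one, frobeniusConjTranspose_one, h] at h2
    exact h2.symm

/-! Both groups have the same quotient by scalars, and scalars do not affect commutation. The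
mechanism is special to dimension 2: `transpose_mul_symplecticPlane_mul` gives `Cᵀ J C = det C • J`.
In a basis of isotropic vectors the Hermitian form becomes a multiple of `J`, so a unitary `C`
satisfies `Cᵀ = det C • C*`; its entry ratios are then Frobenius-fixed, and `C` is a scalar times a
matrix over `F`. Conversely, surjectivity of the norm allows any invertible matrix over `F` to be
rescaled into a unitary one. The pairs matched in this way form a subgroup of the product,
`proportionalConjugates`, which covers both groups. Each projection reflects commutation, so
commuting tuples are full preimages and the probabilities agree. -/

/-- Cardinality of the preimage of a set under a surjective homomorphism of groups. -/
theorem Nat.card_preimage_of_surjective {A B : Type*} [Group A] [Group B] (f : A →* B)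
    (hf : Function.Surjective f) (S : Set B) :
    Nat.card (f ⁻¹' S) = Nat.card S * Nat.card f.ker := by
  rw [← Nat.card_prod]
  refine Nat.card_congr
    { toFun := fun x => (⟨f x, x.2⟩, ⟨x * (Function.surjInv hf (f x))⁻¹, by
        simp [MonoidHom.mem_ker, Function.surjInv_eq]⟩)
      invFun := fun y => ⟨y.2 * Function.surjInv hf y.1, by
        have h := MonoidHom.mem_ker.1 y.2.2
        simp [h, Function.surjInv_eq]⟩
      left_inv := fun x => by simp
      right_inv := fun y => by
        have h := MonoidHom.mem_ker.1 y.2.2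
        ext <;> simp [h, Function.surjInv_eq] }

/-- A surjective homomorphism that reflects commutation preserves commuting probabilities. -/
theorem commutingProbability_eq_of_surjective {A B : Type*} [Group A] [Group B] [Finite A]
    (f : A →* B) (hf : Function.Surjective f)
    (hc : ∀ a b : A, f a * f b = f b * f a → a * b = b * a) (n : ℕ) :
    commutingProbability n A = commutingProbability n B := by
  have hpre : commutingTuples n A = f.compLeft (Fin n) ⁻¹' commutingTuples n B := by
    ext g
    simp only [commutingTuples, Set.mem_ofPred_eq, Set.mem_preimage, MonoidHom.compLeft_apply,
      Function.comp_apply]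
    refine forall₃_congr fun i j _ => ⟨fun h => ?_, hc _ _⟩
    rw [← map_mul, h, map_mul]
  have hF : Function.Surjective (f.compLeft (Fin n)) := hf.comp_left
  have hA : Nat.card A ^ n =
      Nat.card B ^ n * Nat.card (f.compLeft (Fin n)).ker := by
    have h := Nat.card_preimage_of_surjective _ hF Set.univ
    rw [Set.preimage_univ, Nat.card_univ, Nat.card_univ] at h
    simpa [Nat.card_fun] using h
  have hk : (Nat.card (f.compLeft (Fin n)).ker : ℚ) ≠ 0 := Nat.cast_ne_zero.2 Nat.card_pos.ne'
  unfold commutingProbability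
  rw [hpre, Nat.card_preimage_of_surjective _ hF, ← Nat.cast_pow, hA]
  push_cast
  rw [mul_div_mul_right _ _ hk]

/-- Two finite groups linked by a subgroup of their product that projects onto both factors,
and along which commutation in one factor matches commutation in the other, have the same
commuting probabilities. -/
theorem commutingProbability_eq_of_correspondence {A B : Type*} [Group A] [Group B] [Finite A]
    [Finite B] (S : Subgroup (A × B)) (hA : ∀ a, ∃ b, (a, b) ∈ S) (hB : ∀ b, ∃ a, (a, b) ∈ S)
    (hc : ∀ x ∈ S, ∀ y ∈ S, x.1 * y.1 = y.1 * x.1 ↔ x.2 * y.2 = y.2 * x.2) (n : ℕ) :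
    commutingProbability n A = commutingProbability n B := by
  -- Both probabilities equal that of `S` itself.
  rw [← commutingProbability_eq_of_surjective ((MonoidHom.fst A B).comp S.subtype)
      (fun a => (hA a).elim fun b h => ⟨⟨_, h⟩, rfl⟩)
      (fun x y h => Subtype.ext (Prod.ext h ((hc _ x.2 _ y.2).1 h))) n,
    commutingProbability_eq_of_surjective ((MonoidHom.snd A B).comp S.subtype)
      (fun b => (hB b).elim fun a h => ⟨⟨_, h⟩, rfl⟩)
      (fun x y h => Subtype.ext (Prod.ext ((hc _ x.2 _ y.2).2 h) h)) n]

/-! ### Frobenius and norm in a quadratic extension of finite fields. -/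

section QuadraticFrobenius

variable {F K : Type*} [Field F] [Fintype F] [Field K] [Algebra F K]

open FiniteField

theorem frobeniusAlgHom_apply_apply (hK : Module.finrank F K = 2) (x : K) :
    frobeniusAlgHom F K (frobeniusAlgHom F K x) = x := by
  have : FiniteDimensional F K := Module.finite_of_finrank_eq_succ hK
  have : Finite K := Module.finite_of_finite F
  have h := pow_orderOf_eq_one (frobeniusAlgHom F K)
  rw [orderOf_frobeniusAlgHom, hK, pow_two] at h
  exact DFunLike.congr_fun h x

theorem exists_frobeniusAlgHom_ne (hK : Module.finrank F K = 2) :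
    ∃ t : K, frobeniusAlgHom F K t ≠ t := by
  have : FiniteDimensional F K := Module.finite_of_finrank_eq_succ hK
  have : Finite K := Module.finite_of_finite F
  by_contra! h
  have h1 : frobeniusAlgHom F K = 1 := AlgHom.ext h
  have h2 := orderOf_frobeniusAlgHom F K
  rw [h1, orderOf_one, hK] at h2
  omega

theorem exists_mul_frobeniusAlgHom_eq (hK : Module.finrank F K = 2) (c : F) :
    ∃ x : K, x * frobeniusAlgHom F K x = algebraMap F K c := by
  have : FiniteDimensional F K := Module.finite_of_finrank_eq_succ hK
  have : Finite K := Module.finite_of_finite F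
  obtain ⟨x, rfl⟩ := norm_surjective F K c
  refine ⟨x, ?_⟩
  rw [algebraMap_norm_eq_prod_pow, hK]
  simp [Finset.prod_range_succ]

/-- Frobenius generates the Galois group, so its fixed points are fixed by every automorphism. -/
theorem exists_algebraMap_eq_of_frobeniusAlgHom_eq (hK : Module.finrank F K = 2) {x : K}
    (hx : frobeniusAlgHom F K x = x) : ∃ y : F, algebraMap F K y = x := by
  have : FiniteDimensional F K := Module.finite_of_finrank_eq_succ hK
  have : Finite K := Module.finite_of_finite F
  refine (IsGalois.mem_range_algebraMap_iff_fixed x).2 fun g => ?_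
  obtain ⟨i, rfl⟩ := (bijective_frobeniusAlgEquivOfAlgebraic_pow F K).2 g
  have h : frobeniusAlgEquivOfAlgebraic F K x = x := hx
  change (frobeniusAlgEquivOfAlgebraic F K ^ (i : ℕ)) x = x
  induction (i : ℕ) with
  | zero => rfl
  | succ m ih => rw [pow_succ, AlgEquiv.mul_apply, h, ih]

theorem frobeniusConjTranspose_smul {d : ℕ} (c : K) (A : Matrix (Fin d) (Fin d) K) :
    frobeniusConjTranspose F K (c • A) =
      frobeniusAlgHom F K c • frobeniusConjTranspose F K A := by
  ext i j
  simp only [frobeniusConjTranspose, Matrix.transpose_apply, Matrix.map_apply, Matrix.smul_apply,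
    smul_eq_mul, map_mul]

theorem frobeniusConjTranspose_map_algebraMap {d : ℕ} (A : Matrix (Fin d) (Fin d) F) :
    frobeniusConjTranspose F K (A.map (algebraMap F K)) =
      (A.map (algebraMap F K)).transpose := by
  ext i j
  simp only [frobeniusConjTranspose, Matrix.transpose_apply, Matrix.map_apply, AlgHom.commutes]

/-! ### Hermitian and symplectic forms on the plane. -/

/-- The matrix of the standard symplectic form on the plane. -/
def symplecticPlane (K : Type*) [Field K] : Matrix (Fin 2) (Fin 2) K := !![0, 1; -1, 0]

theorem transpose_mul_symplecticPlane_mul (C : Matrix (Fin 2) (Fin 2) K) :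
    C.transpose * symplecticPlane K * C = C.det • symplecticPlane K := by
  ext i j
  fin_cases i <;> fin_cases j <;>
    simp [symplecticPlane, Matrix.mul_apply, Matrix.det_fin_two, Fin.sum_univ_two] <;> ring

theorem isUnit_symplecticPlane : IsUnit (symplecticPlane K) := by
  rw [Matrix.isUnit_iff_isUnit_det]
  simp [symplecticPlane, Matrix.det_fin_two]

/-- The standard Hermitian form on the plane is isometric to a multiple of the symplectic
matrix. -/
theorem exists_frobeniusConjTranspose_mul_self_eq_symplecticPlane
    (hK : Module.finrank F K = 2) :
    ∃ (P : GL (Fin 2) K) (δ : K), δ ≠ 0 ∧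
      frobeniusConjTranspose F K P.val * P.val = δ • symplecticPlane K := by
  obtain ⟨t, ht⟩ := exists_frobeniusAlgHom_ne hK
  obtain ⟨a, ha⟩ := exists_mul_frobeniusAlgHom_eq hK (-1 : F)
  have htt := frobeniusAlgHom_apply_apply hK t
  set σ := frobeniusAlgHom F K
  rw [map_neg, map_one] at ha
  have ha0 : a ≠ 0 := by
    rintro rfl
    simp at ha
  -- Since `a` has norm -1, both columns are isotropic, and they pair to `t - σ t`, nonzero by the
  -- choice of `t`.
  let M : Matrix (Fin 2) (Fin 2) K := !![1, t; a, a * σ t]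
  have hM : M.det ≠ 0 := by
    have h : M.det = a * (σ t - t) := by
      simp only [M, Matrix.det_fin_two_of]
      ring
    rw [h]
    exact mul_ne_zero ha0 (sub_ne_zero.2 ht)
  refine ⟨Matrix.GeneralLinearGroup.mkOfDetNeZero M hM, t - σ t,
    sub_ne_zero.2 ht.symm, ?_⟩
  change frobeniusConjTranspose F K M * M = _
  have hM' : frobeniusConjTranspose F K M = !![1, σ a; σ t, σ a * t] := by
    ext i j
    fin_cases i <;> fin_cases j
    · exact map_one σ
    · rfl
    · rfl
    · exact (map_mul σ a (σ t)).trans (by rw [htt]; rfl)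
  rw [hM']
  simp only [M, symplecticPlane, Matrix.mul_fin_two]
  ext i j
  fin_cases i <;> fin_cases j <;> simp
  · linear_combination ha
  · linear_combination σ t * ha
  · linear_combination t * ha
  · linear_combination t * σ t * ha

/-- A nonzero matrix proportional to its Frobenius conjugate is a multiple of a matrix over the
base field. -/
theorem exists_eq_smul_map_of_frobenius (hK : Module.finrank F K = 2)
    {C : Matrix (Fin 2) (Fin 2) K} (hC : C ≠ 0) {d : K}
    (h : ∀ i j, C i j = d * frobeniusAlgHom F K (C i j)) :
    ∃ (c : K) (A : Matrix (Fin 2) (Fin 2) F), c ≠ 0 ∧ C = c • A.map (algebraMap F K) := by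
  obtain ⟨k, l, hkl⟩ : ∃ k l, C k l ≠ 0 := by
    by_contra! h0
    exact hC (Matrix.ext h0)
  have hs : frobeniusAlgHom F K (C k l) ≠ 0 :=
    (map_ne_zero_iff _ (frobeniusAlgHom F K).injective).2 hkl
  -- The common factor `d` cancels in ratios of entries.
  have hfix : ∀ i j, ∃ y : F, algebraMap F K y = C i j / C k l := fun i j => by
    apply exists_algebraMap_eq_of_frobeniusAlgHom_eq hK
    rw [map_div₀, div_eq_div_iff hs hkl]
    have h1 := h i j
    have h2 := h k l
    linear_combination frobeniusAlgHom F K (C i j) * h2 - frobeniusAlgHom F K (C k l) * h1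
  choose A hA using hfix
  refine ⟨C k l, Matrix.of A, hkl, ?_⟩
  ext i j
  simp only [Matrix.smul_apply, Matrix.map_apply, Matrix.of_apply, hA, smul_eq_mul]
  rw [mul_div_cancel₀ _ hkl]

/-! ### The correspondence between `GL₂` and `U₂`. -/

/-- Pairs `(A, B)` of an invertible matrix over `F` and a unitary matrix over `K` such that `B` is
proportional to the conjugate of `A` by `P`. -/
def proportionalConjugates (F : Type*) {K : Type*} [Field F] [Fintype F] [Field K] [Algebra F K]
    (P : GL (Fin 2) K) : Subgroup (GL (Fin 2) F × finiteUnitaryGroup 2 F K) where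
  carrier := {x | ∃ c : Kˣ, (x.2 : GL (Fin 2) K) =
    Matrix.GeneralLinearGroup.scalar (Fin 2) c *
      MulAut.conj P (Matrix.GeneralLinearGroup.map (algebraMap F K) x.1)}
  one_mem' := ⟨1, by simp⟩
  mul_mem' := by
    rintro x y ⟨c, hc⟩ ⟨d, hd⟩
    refine ⟨c * d, ?_⟩
    rw [Prod.snd_mul, Subgroup.coe_mul, hc, hd, Prod.fst_mul, map_mul, map_mul, map_mul]
    exact Commute.mul_mul_mul_comm (Matrix.GeneralLinearGroup.scalar_commute d _).symm _ _
  inv_mem' := by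
    rintro x ⟨c, hc⟩
    refine ⟨c⁻¹, ?_⟩
    rw [Prod.snd_inv, Subgroup.coe_inv, hc, Prod.fst_inv, map_inv, map_inv, map_inv, mul_inv_rev]
    exact (Matrix.GeneralLinearGroup.scalar_commute c⁻¹ _).symm

theorem Matrix.GeneralLinearGroup.scalar_mul_mul_comm_iff (c d : Kˣ) (A B : GL (Fin 2) K) :
    scalar (Fin 2) c * A * (scalar (Fin 2) d * B) = scalar (Fin 2) d * B * (scalar (Fin 2) c * A) ↔
      A * B = B * A := by
  have h1 := Commute.mul_mul_mul_comm (scalar_commute d A).symm (scalar (Fin 2) c) B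
  have h2 := Commute.mul_mul_mul_comm (scalar_commute c B).symm (scalar (Fin 2) d) A
  rw [h1, h2, ← map_mul, ← map_mul, mul_comm d c, mul_right_inj]

theorem fst_mul_comm_iff_of_mem_proportionalConjugates (P : GL (Fin 2) K)
    {x y : GL (Fin 2) F × finiteUnitaryGroup 2 F K} (hx : x ∈ proportionalConjugates F P)
    (hy : y ∈ proportionalConjugates F P) :
    x.1 * y.1 = y.1 * x.1 ↔ x.2 * y.2 = y.2 * x.2 := by
  obtain ⟨c, hc⟩ := hx
  obtain ⟨d, hd⟩ := hy
  have hinj : Function.Injective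
      (Matrix.GeneralLinearGroup.map (n := Fin 2) (algebraMap F K)) :=
    Units.map_injective (Matrix.map_injective (algebraMap F K).injective)
  rw [← Subtype.coe_inj, Subgroup.coe_mul, Subgroup.coe_mul, hc, hd,
    Matrix.GeneralLinearGroup.scalar_mul_mul_comm_iff, ← map_mul, ← map_mul, ← map_mul, ← map_mul,
    (MulAut.conj P).injective.eq_iff, hinj.eq_iff]

theorem mem_finiteUnitaryGroup_iff_of_conj {P : GL (Fin 2) K} {δ : K} (hδ : δ ≠ 0)
    (hP : frobeniusConjTranspose F K P.val * P.val = δ • symplecticPlane K) (C : GL (Fin 2) K) :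
    MulAut.conj P C ∈ finiteUnitaryGroup 2 F K ↔
      frobeniusConjTranspose F K C.val * symplecticPlane K * C.val = symplecticPlane K := by
  set B := MulAut.conj P C
  have hBP : B.val * P.val = P.val * C.val := by
    rw [← Units.val_mul, ← Units.val_mul]
    simp [B, MulAut.conj_apply]
  have hPu : IsUnit P.val := P.isUnit
  have hPs : IsUnit (frobeniusConjTranspose F K P.val) := by
    refine IsUnit.of_mul_eq_one (frobeniusConjTranspose F K (P⁻¹).val) ?_
    rw [← frobeniusConjTranspose_mul, ← Units.val_mul, inv_mul_cancel, Units.val_one,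
      frobeniusConjTranspose_one]
  have key : frobeniusConjTranspose F K P.val *
      (frobeniusConjTranspose F K B.val * B.val) * P.val =
      δ • (frobeniusConjTranspose F K C.val * symplecticPlane K * C.val) := by
    calc _ = frobeniusConjTranspose F K (B.val * P.val) * (B.val * P.val) := by
          rw [frobeniusConjTranspose_mul]; simp only [mul_assoc]
      _ = frobeniusConjTranspose F K C.val *
          (frobeniusConjTranspose F K P.val * P.val) * C.val := by
          rw [hBP, frobeniusConjTranspose_mul]; simp only [mul_assoc]
      _ = _ := by rw [hP, Matrix.mul_smul, Matrix.smul_mul]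
  change frobeniusConjTranspose F K B.val * B.val = 1 ↔ _
  constructor
  · intro h
    rw [h, mul_one, hP] at key
    exact (smul_right_injective _ hδ key).symm
  · intro h
    rw [h, ← hP] at key
    refine hPs.mul_left_cancel (hPu.mul_right_cancel ?_)
    rw [key, mul_one]

theorem exists_mem_proportionalConjugates_of_fst (hK : Module.finrank F K = 2)
    {P : GL (Fin 2) K} {δ : K} (hδ : δ ≠ 0)
    (hP : frobeniusConjTranspose F K P.val * P.val = δ • symplecticPlane K) (A : GL (Fin 2) F) :
    ∃ B, (A, B) ∈ proportionalConjugates F P := by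
  -- Scaling by `c` multiplies the form by the norm of `c`, which must cancel `det A`.
  obtain ⟨c, hc⟩ := exists_mul_frobeniusAlgHom_eq hK A.val.det⁻¹
  have hdet : algebraMap F K A.val.det ≠ 0 :=
    (map_ne_zero_iff _ (algebraMap F K).injective).2 (Matrix.GeneralLinearGroup.det_ne_zero A)
  have hc0 : c ≠ 0 := by
    rintro rfl
    rw [zero_mul, map_inv₀] at hc
    exact inv_ne_zero hdet hc.symm
  set A' := Matrix.GeneralLinearGroup.map (algebraMap F K) A
  set z := Matrix.GeneralLinearGroup.scalar (Fin 2) (Units.mk0 c hc0)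
  have hz : z * MulAut.conj P A' = MulAut.conj P (z * A') := by
    rw [map_mul, MulAut.conj_apply (h := z), ← Matrix.GeneralLinearGroup.scalar_commute,
      mul_inv_cancel_right]
  have hval : (z * A').val = c • A.val.map (algebraMap F K) := by
    ext i j
    simp [z, A', Matrix.GeneralLinearGroup.coe_scalar]
  have hmem : z * MulAut.conj P A' ∈ finiteUnitaryGroup 2 F K := by
    rw [hz, mem_finiteUnitaryGroup_iff_of_conj hδ hP, hval, frobeniusConjTranspose_smul,
      frobeniusConjTranspose_map_algebraMap, Matrix.mul_smul, Matrix.smul_mul, Matrix.smul_mul,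
      transpose_mul_symplecticPlane_mul, smul_smul, smul_smul, hc, ← RingHom.mapMatrix_apply,
      ← RingHom.map_det, map_inv₀, inv_mul_cancel₀ hdet, one_smul]
  exact ⟨⟨_, hmem⟩, Units.mk0 c hc0, rfl⟩

theorem exists_mem_proportionalConjugates_of_snd (hK : Module.finrank F K = 2)
    {P : GL (Fin 2) K} {δ : K} (hδ : δ ≠ 0)
    (hP : frobeniusConjTranspose F K P.val * P.val = δ • symplecticPlane K)
    (B : finiteUnitaryGroup 2 F K) :
    ∃ A, (A, B) ∈ proportionalConjugates F P := by
  obtain ⟨C, hCB⟩ := (MulAut.conj P).surjective B.val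
  have hC := (mem_finiteUnitaryGroup_iff_of_conj hδ hP C).1 (hCB ▸ B.2)
  -- The symplectic identity and the unitarity of `C` share the right factor `J C`, which is
  -- invertible.
  have hCt : C.val.transpose = C.val.det • frobeniusConjTranspose F K C.val := by
    refine (isUnit_symplecticPlane (K := K)).mul_right_cancel (C.isUnit.mul_right_cancel ?_)
    rw [transpose_mul_symplecticPlane_mul, Matrix.smul_mul, Matrix.smul_mul, hC]
  have hC0 : C.val ≠ 0 := C.ne_zero
  obtain ⟨c, A, hc, hA⟩ := exists_eq_smul_map_of_frobenius hK hC0 (d := C.val.det)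
    fun i j => congrFun (congrFun hCt j) i
  have hdet : A.det ≠ 0 := by
    intro h
    apply Matrix.GeneralLinearGroup.det_ne_zero C
    rw [hA, Matrix.det_smul, ← RingHom.mapMatrix_apply, ← RingHom.map_det, h, map_zero, mul_zero]
  refine ⟨Matrix.GeneralLinearGroup.mkOfDetNeZero A hdet, Units.mk0 c hc, ?_⟩
  set z := Matrix.GeneralLinearGroup.scalar (Fin 2) (Units.mk0 c hc)
  have hCz : C = z * Matrix.GeneralLinearGroup.map (algebraMap F K)
      (Matrix.GeneralLinearGroup.mkOfDetNeZero A hdet) := by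
    apply Units.ext
    rw [hA]
    ext i j
    simp [z, Matrix.GeneralLinearGroup.coe_scalar, Matrix.GeneralLinearGroup.mkOfDetNeZero]
  change B.val = _
  rw [← hCB, hCz, map_mul, MulAut.conj_apply (h := z),
    ← Matrix.GeneralLinearGroup.scalar_commute, mul_inv_cancel_right]

end QuadraticFrobenius

theorem mainTheorem1 (F K : Type*) [Field F] [Fintype F] [Field K] [Algebra F K]
    (hK : Module.finrank F K = 2) (n : ℕ) (hn : 2 ≤ n) :
    commutingProbability n (GL (Fin 2) F) =
      commutingProbability n (finiteUnitaryGroup 2 F K) := by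
  have : FiniteDimensional F K := Module.finite_of_finrank_eq_succ hK
  have : Finite K := Module.finite_of_finite F
  obtain ⟨P, δ, hδ, hP⟩ := exists_frobeniusConjTranspose_mul_self_eq_symplecticPlane hK
  exact commutingProbability_eq_of_correspondence (proportionalConjugates F P)
    (exists_mem_proportionalConjugates_of_fst hK hδ hP)
    (exists_mem_proportionalConjugates_of_snd hK hδ hP)
    (fun _ hx _ hy => fst_mul_comm_iff_of_mem_proportionalConjugates P hx hy) n
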